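/- Let $n\ge 1$ be an integer, $p\in(0,\infty)$, let $\mathbf U$ be a random vector in $\mathbb R^n$ and $\mathbf V$ a random variable on the same probability space, with values in an arbitrary measurable space (for instance $\mathbb R^n$). Let $|\cdot|$ be the Euclidean norm, $\log$ the logarithm in base $2$ with $\log 0=-\infty$, and \[ \|\mathbf U\|_p=\Big(\tfrac1n\,\mathbb E\big[\mathrm{Tr}^{p/2}(\mathbf U\mathbf U^T)\big]\Big)^{1/p}=\Big(\tfrac1n\,\mathbb E|\mathbf U|^p\Big)^{1/p},\qquad \mathrm{mmpe}(\mathbf U|\mathbf V;p)=\inf_f\|\mathbf U-f(\mathbf V)\|_p^p, \] the infimum being over all measurable functions $f$ with values in $\mathbb R^n$. The differential entropy $h(\mathbf U)=-\int g\log g\,dx$ is taken with respect to the Lebesgue density $g$ of $\mathbf U$, with $h(\mathbf U)=-\infty$ if the law of $\mathbf U$ is not absolutely continuous, and $h(\mathbf U|\mathbf V)=\int h(\mathbf U|\mathbf V=\mathbf v)\,dP_{\mathbf V}(\mathbf v)$, where $h(\mathbf U|\mathbf V=\mathbf v)$ is the differential entropy of the regular conditional law of $\mathbf U$ given $\mathbf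 V=\mathbf v$; all these quantities are extended real numbers. **Theorem.** If $h(\mathbf U)<\infty$ and $\|\mathbf U\|_p<\infty$, then $h(\mathbf U|\mathbf V)$ is well defined in $[-\infty,\infty)$ and \[ h(\mathbf U|\mathbf V)\le\frac n2\log\Big(k_{n,p}^2\cdot n^{2/p}\cdot \mathrm{mmpe}^{2/p}(\mathbf U|\mathbf V;p)\Big), \qquad k_{n,p}=\frac{\sqrt\pi\,\big(\tfrac pn\big)^{1/p}e^{1/p}\,\Gamma\big(\tfrac np+1\big)^{1/n}}{\Gamma\big(\tfrac n2+1\big)^{1/n}} . \] Moreover \[ k_{n,p}=\sqrt{2\pi e}\;\frac{1}{n^{1/2}\,(p/2)^{1/(2n)}}+o\Big(\frac np\Big)\qquad\text{as } \frac np\to\infty , \] jointly in the integers $n\ge1$ and the reals $p>0$. -/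

import Mathlib

open MeasureTheory ProbabilityTheory
open scoped ENNReal Asymptotics

/-- The extended-real integral `∫ f⁺ dμ - ∫ f⁻ dμ` of an extended-real valued function.
It is the usual integral whenever one of the two parts is finite. In the undefined case `∞ - ∞`
the value is `∞`, so that `extIntegral μ f < ∞` means that the integral exists in `[-∞, ∞)`. -/
noncomputable def extIntegral {α : Type*} [MeasurableSpace α] (μ : Measure α) (f : α → EReal) :
    EReal :=
  if ∫⁻ x, (f x).toENNReal ∂μ = ⊤ then ⊤
  else ((∫⁻ x, (f x).toENNReal ∂μ : ℝ≥0∞) : EReal) - ((∫⁻ x, (-f x).toENNReal ∂μ : ℝ≥0∞) : EReal)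

/-- Differential entropy (in bits) of a probability law `μ` on `ℝⁿ`: if `μ` has a Lebesgue density
`g`, it is `-∫ g(x) log₂ g(x) dx ∈ [-∞, ∞]`; if `μ` is not absolutely continuous with respect to
Lebesgue measure, it is `-∞` by the usual convention. -/
noncomputable def diffEntropy {n : ℕ} (μ : Measure (EuclideanSpace ℝ (Fin n))) : EReal :=
  open scoped Classical in
  if μ ≪ volume then
    extIntegral volume fun x =>
      ((-((μ.rnDeriv volume x).toReal * Real.logb 2 (μ.rnDeriv volume x).toReal) : ℝ) : EReal)
  else ⊥

/-- Conditional differential entropy `h(U | V) = ∫ h(U | V = v) dP_V(v)` (in bits), where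
`h(U | V = v)` is the differential entropy of the regular conditional law of `U` given `V = v`. -/
noncomputable def condDiffEntropy {Ω β : Type*} [MeasurableSpace Ω] [MeasurableSpace β]
    (P : Measure Ω) [IsProbabilityMeasure P] {n : ℕ}
    (U : Ω → EuclideanSpace ℝ (Fin n)) (V : Ω → β) : EReal :=
  extIntegral (P.map V) fun v => diffEntropy (condDistrib U V P v)

/-- The normalized `p`-norm `‖U‖_p = (n⁻¹ E[Tr(U Uᵀ)^(p/2)])^(1/p)` of a random vector in `ℝⁿ`,
with values in `[0, ∞]`; note `Tr(u uᵀ)^(p/2) = |u|^p` for the Euclidean norm `|u|`. -/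
noncomputable def pNorm {Ω : Type*} [MeasurableSpace Ω] (P : Measure Ω) {n : ℕ} (p : ℝ)
    (U : Ω → EuclideanSpace ℝ (Fin n)) : ℝ≥0∞ :=
  ((n : ℝ≥0∞)⁻¹ * ∫⁻ ω, ‖U ω‖ₑ ^ p ∂P) ^ (1 / p)

/-- Minimum mean `p`-th error `mmpe(U | V; p) = inf_f ‖U - f(V)‖_p ^ p` of estimating `U` from `V`,
the infimum being over all measurable functions `f`. -/
noncomputable def mmpe {Ω β : Type*} [MeasurableSpace Ω] [MeasurableSpace β]
    (P : Measure Ω) {n : ℕ} (U : Ω → EuclideanSpace ℝ (Fin n)) (V : Ω → β) (p : ℝ) : ℝ≥0∞ :=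
  ⨅ (f : β → EuclideanSpace ℝ (Fin n)) (_ : Measurable f),
    pNorm P p (fun ω => U ω - f (V ω)) ^ p

/-- The constant `k_{n,p}`. -/
noncomputable def kConst (n : ℕ) (p : ℝ) : ℝ :=
  √Real.pi * (p / n) ^ (1 / p) * Real.exp (1 / p) * Real.Gamma (n / p + 1) ^ (1 / (n : ℝ)) /
    Real.Gamma (n / 2 + 1) ^ (1 / (n : ℝ))

/-- The logarithm in base 2 on `[0, ∞]`, with `log₂ 0 = -∞` and `log₂ ∞ = ∞`. -/
noncomputable def extLogTwo (x : ℝ≥0∞) : EReal :=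
  ENNReal.log x / ((Real.log 2 : ℝ) : EReal)

/-! For a law with density g, Gibbs' inequality against the density q = exp(-c|x-a|^p)/Z bounds its
entropy by log Z + c E|X-a|^p (`diffEntropy_le`). The bound is affine in the p-th moment. Hence,
taking a = f(v) for the conditional law at v and one c for all v, it integrates over v to the same
expression in E|U-f(V)|^p (`condDiffEntropy_le_of_estimator`). Optimising over c produces k_{n,p}
(`genGaussian_bound_eq`), and continuity of the bound passes to the infimum over f. The bound lies
below ⊤ because the mmpe is finite, which by the convention of `extIntegral` is what makes h(U|V)
well defined.

The asymptotic statement only asks for an o(n/p) error, and both terms of the difference are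
O(√(n/p)) by Stirling-type bounds. -/

/-! ### Comparison of extended integrals. -/

/-- No measurability of `f` is needed: the integrals in `extIntegral` are lower integrals. -/
theorem extIntegral_le_integral {α : Type*} [MeasurableSpace α] {μ : Measure α} {f : α → EReal}
    {r : α → ℝ} (hr : Integrable r μ) (h : ∀ᵐ x ∂μ, f x ≤ (r x : EReal)) :
    extIntegral μ f ≤ ((∫ x, r x ∂μ : ℝ) : EReal) := by
  have hpos : ∫⁻ x, ENNReal.ofReal (r x) ∂μ ≠ ⊤ := hr.lintegral_lt_top.ne
  have hneg : ∫⁻ x, ENNReal.ofReal (-r x) ∂μ ≠ ⊤ := hr.neg.lintegral_lt_top.ne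
  have hfle : ∫⁻ x, (f x).toENNReal ∂μ ≤ ∫⁻ x, ENNReal.ofReal (r x) ∂μ := by
    refine lintegral_mono_ae ?_
    filter_upwards [h] with x hx
    simpa using EReal.toENNReal_le_toENNReal hx
  have hftop : ∫⁻ x, (f x).toENNReal ∂μ ≠ ⊤ := ne_top_of_le_ne_top hpos hfle
  -- f ≤ r rearranged as f⁺ + r⁻ ≤ r⁺ + f⁻, which avoids subtraction and stays meaningful when f =
  -- -∞.
  have hkey : ∫⁻ x, (f x).toENNReal ∂μ + ∫⁻ x, ENNReal.ofReal (-r x) ∂μ ≤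
      ∫⁻ x, ENNReal.ofReal (r x) ∂μ + ∫⁻ x, (-f x).toENNReal ∂μ := by
    rw [← lintegral_add_right' _ (show AEMeasurable (fun x => ENNReal.ofReal (-r x)) μ from
        hr.1.aemeasurable.neg.ennreal_ofReal),
      ← lintegral_add_left' hr.1.aemeasurable.ennreal_ofReal]
    refine lintegral_mono_ae ?_
    filter_upwards [h] with x hx
    induction hy : f x with
    | bot => simp
    | top => simp [hy] at hx
    | coe y =>
      rw [hy, EReal.coe_le_coe_iff] at hx
      rw [← EReal.coe_neg, EReal.toENNReal_of_ne_top (by simp),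
        EReal.toENNReal_of_ne_top (by simp), EReal.toReal_coe, EReal.toReal_coe]
      rcases le_total 0 (r x) with h1 | h1 <;> rcases le_total 0 y with h2 | h2
      · rw [ENNReal.ofReal_of_nonpos (by linarith : -r x ≤ 0), add_zero]
        exact (ENNReal.ofReal_le_ofReal hx).trans le_self_add
      · rw [ENNReal.ofReal_of_nonpos h2, ENNReal.ofReal_of_nonpos (by linarith : -r x ≤ 0)]
        simp
      · have : r x = y := by linarith
        rw [this, show y = 0 by linarith]
      · rw [ENNReal.ofReal_of_nonpos h2, zero_add]
        exact (ENNReal.ofReal_le_ofReal (by linarith)).trans le_add_self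
  rw [extIntegral, if_neg hftop, integral_eq_lintegral_pos_part_sub_lintegral_neg_part hr]
  rcases eq_or_ne (∫⁻ x, (-f x).toENNReal ∂μ) ⊤ with htop | htop
  · simp [htop]
  · lift ∫⁻ x, (f x).toENNReal ∂μ to NNReal using hftop with a
    lift ∫⁻ x, (-f x).toENNReal ∂μ to NNReal using htop with b
    lift ∫⁻ x, ENNReal.ofReal (r x) ∂μ to NNReal using hpos with c
    lift ∫⁻ x, ENNReal.ofReal (-r x) ∂μ to NNReal using hneg with d
    rw [EReal.coe_nnreal_eq_coe_real, EReal.coe_nnreal_eq_coe_real, ← EReal.coe_sub,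
      EReal.coe_le_coe_iff, ENNReal.coe_toReal, ENNReal.coe_toReal]
    have : (a : ℝ) + d ≤ c + b := by exact_mod_cast hkey
    linarith

/-! ### Normalisation of the generalized Gaussian density. -/

/-- The constant `∫ exp (-‖x‖ ^ p) dx` over `ℝⁿ`. -/
noncomputable def genGaussianConst (n : ℕ) (p : ℝ) : ℝ :=
  √Real.pi ^ n / Real.Gamma (n / 2 + 1) * Real.Gamma (n / p + 1)

theorem genGaussianConst_pos (n : ℕ) {p : ℝ} (hp : 0 < p) : 0 < genGaussianConst n p := by
  have h1 : 0 < Real.Gamma ((n : ℝ) / 2 + 1) := Real.Gamma_pos_of_pos (by positivity)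
  have h2 : 0 < Real.Gamma ((n : ℝ) / p + 1) := Real.Gamma_pos_of_pos (by positivity)
  have h3 : 0 < Real.pi := Real.pi_pos
  unfold genGaussianConst
  positivity

/-- Two formulas for the volume of the unit ball are compared: the Euclidean one, and the one
expressing it through this integral. -/
theorem integral_exp_neg_norm_rpow {n : ℕ} (hn : 1 ≤ n) {p : ℝ} (hp : 0 < p) :
    ∫ x : EuclideanSpace ℝ (Fin n), Real.exp (-‖x‖ ^ p) = genGaussianConst n p := by
  have : Nonempty (Fin n) := ⟨⟨0, hn⟩⟩
  have hΓ : 0 < Real.Gamma ((n : ℝ) / p + 1) := Real.Gamma_pos_of_pos (by positivity)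
  have hΓ2 : 0 < Real.Gamma ((n : ℝ) / 2 + 1) := Real.Gamma_pos_of_pos (by positivity)
  have h := measure_unitBall_eq_integral_div_gamma
    (volume : Measure (EuclideanSpace ℝ (Fin n))) hp
  rw [EuclideanSpace.volume_ball, finrank_euclideanSpace] at h
  simp only [Fintype.card_fin, ENNReal.ofReal_one, one_pow, one_mul] at h
  rw [ENNReal.ofReal_eq_ofReal_iff (by positivity)
    (div_nonneg (integral_nonneg fun _ => (Real.exp_pos _).le) hΓ.le)] at h
  rw [genGaussianConst, h, div_mul_cancel₀ _ hΓ.ne']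

theorem integrable_exp_neg_norm_rpow {n : ℕ} (hn : 1 ≤ n) {p : ℝ} (hp : 0 < p) :
    Integrable fun x : EuclideanSpace ℝ (Fin n) => Real.exp (-‖x‖ ^ p) := by
  by_contra h
  have := integral_exp_neg_norm_rpow hn hp
  -- A non-integrable function has Bochner integral 0, but the value is positive.
  rw [integral_undef h] at this
  exact (genGaussianConst_pos n hp).ne this

theorem exp_neg_mul_norm_sub_rpow_eq {E : Type*} [NormedAddCommGroup E] [NormedSpace ℝ E]
    {p c : ℝ} (hp : 0 < p) (hc : 0 < c) (a x : E) :
    Real.exp (-(c * ‖x - a‖ ^ p)) = Real.exp (-‖c ^ (1 / p) • (x - a)‖ ^ p) := by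
  rw [norm_smul, Real.norm_of_nonneg (by positivity), Real.mul_rpow (by positivity) (by positivity),
    ← Real.rpow_mul hc.le, one_div_mul_cancel hp.ne', Real.rpow_one]

theorem integrable_exp_neg_mul_norm_sub_rpow {n : ℕ} (hn : 1 ≤ n) {p c : ℝ} (hp : 0 < p)
    (hc : 0 < c) (a : EuclideanSpace ℝ (Fin n)) :
    Integrable fun x : EuclideanSpace ℝ (Fin n) => Real.exp (-(c * ‖x - a‖ ^ p)) := by
  simp_rw [exp_neg_mul_norm_sub_rpow_eq hp hc]
  exact ((integrable_exp_neg_norm_rpow hn hp).comp_smul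
    (R := c ^ (1 / p)) (by positivity)).comp_sub_right a

theorem integral_exp_neg_mul_norm_sub_rpow {n : ℕ} (hn : 1 ≤ n) {p c : ℝ} (hp : 0 < p)
    (hc : 0 < c) (a : EuclideanSpace ℝ (Fin n)) :
    ∫ x : EuclideanSpace ℝ (Fin n), Real.exp (-(c * ‖x - a‖ ^ p)) =
      c ^ (-(n / p)) * genGaussianConst n p := by
  simp_rw [exp_neg_mul_norm_sub_rpow_eq hp hc]
  rw [integral_sub_right_eq_self (fun x : EuclideanSpace ℝ (Fin n) =>
      Real.exp (-‖c ^ (1 / p) • x‖ ^ p)) a,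
    Measure.integral_comp_smul volume (fun x : EuclideanSpace ℝ (Fin n) => Real.exp (-‖x‖ ^ p)),
    integral_exp_neg_norm_rpow hn hp, finrank_euclideanSpace, Fintype.card_fin, smul_eq_mul,
    abs_of_nonneg (by positivity), ← Real.rpow_natCast, ← Real.rpow_mul hc.le,
    ← Real.rpow_neg hc.le]
  congr 2
  ring

/-! ### Maximum entropy under a p-th moment constraint. -/

/-- **Gibbs' inequality**, pointwise form. -/
theorem neg_mul_log_le_neg_mul_log_add {g q : ℝ} (hg : 0 ≤ g) (hq : 0 < q) :
    -(g * Real.log g) ≤ -(g * Real.log q) + (q - g) := by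
  rcases hg.eq_or_lt with rfl | hg
  · simpa using hq.le
  · have h := Real.log_le_sub_one_of_pos (div_pos hq hg)
    rw [Real.log_div hq.ne' hg.ne'] at h
    have h2 := mul_le_mul_of_nonneg_left h hg.le
    have h3 : g * (q / g - 1) = q - g := by field_simp
    nlinarith

theorem diffEntropy_le {n : ℕ} (hn : 1 ≤ n) {p c : ℝ} (hp : 0 < p) (hc : 0 < c)
    (a : EuclideanSpace ℝ (Fin n)) (μ : Measure (EuclideanSpace ℝ (Fin n)))
    [IsProbabilityMeasure μ] (hμ : Integrable (fun x => ‖x - a‖ ^ p) μ) :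
    diffEntropy μ ≤ (((Real.log (c ^ (-(n / p)) * genGaussianConst n p) +
      c * ∫ x, ‖x - a‖ ^ p ∂μ) / Real.log 2 : ℝ) : EReal) := by
  by_cases hac : μ ≪ volume
  swap
  · rw [diffEntropy, if_neg hac]; exact bot_le
  rw [diffEntropy, if_pos hac]
  set Z := c ^ (-(n / p)) * genGaussianConst n p
  have hZpos : 0 < Z := mul_pos (by positivity) (genGaussianConst_pos n hp)
  set g := fun x => (μ.rnDeriv volume x).toReal
  have hlog2 : 0 < Real.log 2 := Real.log_pos one_lt_two
  have hI0 : Integrable (fun x => Real.log Z + c * ‖x - a‖ ^ p) μ :=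
    (integrable_const _).add (hμ.const_mul c)
  have hI1 : Integrable (fun x => g x * (Real.log Z + c * ‖x - a‖ ^ p)) :=
    (integrable_rnDeriv_smul_iff hac).2 hI0
  have hI2 : Integrable (fun x => Real.exp (-(c * ‖x - a‖ ^ p)) / Z) :=
    (integrable_exp_neg_mul_norm_sub_rpow hn hp hc a).div_const Z
  have hI3 : Integrable g := Measure.integrable_toReal_rnDeriv
  have hI23 : Integrable (fun x => Real.exp (-(c * ‖x - a‖ ^ p)) / Z - g x) := hI2.sub hI3
  -- The correction q - g integrates to 0, both being probability densities; only the cross entropy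
  -- remains.
  have hint : ∫ x, (g x * (Real.log Z + c * ‖x - a‖ ^ p) +
      (Real.exp (-(c * ‖x - a‖ ^ p)) / Z - g x)) / Real.log 2 =
      (Real.log Z + c * ∫ x, ‖x - a‖ ^ p ∂μ) / Real.log 2 := by
    rw [integral_div, integral_add hI1 hI23, integral_sub hI2 hI3, integral_div,
      integral_exp_neg_mul_norm_sub_rpow hn hp hc a, div_self hZpos.ne',
      Measure.integral_toReal_rnDeriv hac]
    have : ∫ x, g x * (Real.log Z + c * ‖x - a‖ ^ p) =
        ∫ x, (Real.log Z + c * ‖x - a‖ ^ p) ∂μ := integral_rnDeriv_smul hac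
    rw [this, integral_add (integrable_const _) (hμ.const_mul c), integral_const_mul]
    simp
  rw [← hint]
  refine extIntegral_le_integral ((hI1.add hI23).div_const _) (ae_of_all _ fun x => ?_)
  rw [EReal.coe_le_coe_iff, Real.logb, ← mul_div_assoc, ← neg_div]
  refine div_le_div_of_nonneg_right ?_ hlog2.le
  refine (neg_mul_log_le_neg_mul_log_add ENNReal.toReal_nonneg
    (div_pos (Real.exp_pos (-(c * ‖x - a‖ ^ p))) hZpos)).trans_eq ?_
  rw [Real.log_div (Real.exp_pos _).ne' hZpos.ne', Real.log_exp]
  simp only [g]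
  ring

theorem condDiffEntropy_le_of_estimator {Ω β : Type*} [MeasurableSpace Ω] [MeasurableSpace β]
    (P : Measure Ω) [IsProbabilityMeasure P] {n : ℕ} (hn : 1 ≤ n) {p c : ℝ} (hp : 0 < p)
    (hc : 0 < c) {U : Ω → EuclideanSpace ℝ (Fin n)} (hU : Measurable U) {V : Ω → β}
    (hV : Measurable V) {f : β → EuclideanSpace ℝ (Fin n)} (hf : Measurable f)
    (hfin : ∫⁻ ω, ‖U ω - f (V ω)‖ₑ ^ p ∂P ≠ ⊤) :
    condDiffEntropy P U V ≤ (((Real.log (c ^ (-(n / p)) * genGaussianConst n p) +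
      c * (∫⁻ ω, ‖U ω - f (V ω)‖ₑ ^ p ∂P).toReal) / Real.log 2 : ℝ) : EReal) := by
  have : IsProbabilityMeasure (P.map V) := Measure.isProbabilityMeasure_map hV.aemeasurable
  set κ := condDistrib U V P
  have hmeas : Measurable fun z : β × EuclideanSpace ℝ (Fin n) => ‖z.2 - f z.1‖ₑ ^ p := by
    fun_prop
  -- Disintegration of the joint law: the mean error is the average over v of the p-th moment of the
  -- conditional law about f(v).
  have hdis : ∫⁻ ω, ‖U ω - f (V ω)‖ₑ ^ p ∂P =
      ∫⁻ v, ∫⁻ u, ‖u - f v‖ₑ ^ p ∂(κ v) ∂(P.map V) := by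
    rw [← Measure.lintegral_compProd hmeas, compProd_map_condDistrib hU.aemeasurable,
      lintegral_map hmeas (hV.prodMk hU)]
  rw [hdis] at hfin ⊢
  set F : β → ℝ≥0∞ := fun v => ∫⁻ u, ‖u - f v‖ₑ ^ p ∂(κ v)
  have hF : Measurable F := hmeas.lintegral_kernel_prod_right'
  have hFtop : ∀ᵐ v ∂(P.map V), F v < ⊤ := ae_lt_top hF hfin
  have hFint : Integrable (fun v => (F v).toReal) (P.map V) :=
    integrable_toReal_of_lintegral_ne_top hF.aemeasurable hfin
  have hint : ∫ v, (Real.log (c ^ (-(n / p)) * genGaussianConst n p) + c * (F v).toReal) /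
      Real.log 2 ∂(P.map V) = (Real.log (c ^ (-(n / p)) * genGaussianConst n p) +
      c * (∫⁻ v, F v ∂(P.map V)).toReal) / Real.log 2 := by
    rw [integral_div, integral_add (integrable_const _) (hFint.const_mul c), integral_const_mul,
      integral_toReal hF.aemeasurable hFtop]
    simp
  rw [← hint]
  refine extIntegral_le_integral
    (((integrable_const _).add (hFint.const_mul c)).div_const _) ?_
  filter_upwards [hFtop] with v hv
  have henorm : ∀ u, ENNReal.ofReal (‖u - f v‖ ^ p) = ‖u - f v‖ₑ ^ p := fun u => by
    rw [← ENNReal.ofReal_rpow_of_nonneg (norm_nonneg _) hp.le, ofReal_norm]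
  have hsm : AEStronglyMeasurable (fun u => ‖u - f v‖ ^ p) (κ v) :=
    Measurable.aestronglyMeasurable (by fun_prop)
  have hI : Integrable (fun u => ‖u - f v‖ ^ p) (κ v) := by
    refine (lintegral_ofReal_ne_top_iff_integrable hsm
      (ae_of_all _ fun u => by positivity)).1 ?_
    simp_rw [henorm]
    exact hv.ne
  refine (diffEntropy_le hn hp hc (f v) (κ v) hI).trans_eq ?_
  rw [integral_eq_lintegral_of_nonneg_ae (ae_of_all _ fun u => by positivity) hsm]
  simp_rw [henorm]
  rfl

/-! ### Growth of k_{n,p} as n/p → ∞. -/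

/-- The Stirling sequence n!/(√(2n)(n/e)^n) decreases, so it is at most its first term e/√2. -/
theorem log_factorial_le {n : ℕ} (hn : 1 ≤ n) :
    Real.log (n.factorial : ℝ) ≤ 1 + Real.log n / 2 + n * Real.log n - n := by
  obtain ⟨m, rfl⟩ := Nat.exists_eq_succ_of_ne_zero (by omega : n ≠ 0)
  have h := Stirling.log_stirlingSeq'_antitone (Nat.zero_le m)
  simp only [Function.comp_apply, Nat.succ_eq_add_one, zero_add] at h
  rw [Stirling.stirlingSeq_one, Stirling.log_stirlingSeq_formula,
    Real.log_div (Real.exp_pos _).ne' (by positivity), Real.log_exp,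
    Real.log_sqrt (by positivity), Real.log_mul two_ne_zero (by positivity),
    Real.log_div (by positivity) (Real.exp_pos _).ne', Real.log_exp] at h
  simp only [Nat.succ_eq_add_one]
  linarith

/-- Convexity of log Γ interpolates between m+1 and m+2, with m = ⌊x⌋. The constant 3 is 1 from the
factorial bound plus 2(x-m) ≤ 2 from the rounding. -/
theorem log_Gamma_add_one_le {x : ℝ} (hx : 1 ≤ x) :
    Real.log (Real.Gamma (x + 1)) ≤ 3 + Real.log x / 2 + x * Real.log x - x := by
  have hx0 : 0 < x := by linarith
  set m : ℕ := ⌊x⌋₊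
  have hm : 1 ≤ m := (Nat.one_le_floor_iff x).2 hx
  have hmx : (m : ℝ) ≤ x := Nat.floor_le hx0.le
  have hxm : x < m + 1 := Nat.lt_floor_add_one x
  have hm1 : (1 : ℝ) ≤ m := by exact_mod_cast hm
  have hconv := Real.convexOn_log_Gamma.2 (Set.mem_Ioi.2 (by positivity : 0 < (m : ℝ) + 1))
    (Set.mem_Ioi.2 (by positivity : 0 < (m : ℝ) + 1 + 1)) (by linarith : 0 ≤ 1 - (x - m))
    (by linarith : 0 ≤ x - m) (by ring)
  simp only [Function.comp_apply, smul_eq_mul] at hconv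
  rw [show (1 - (x - m)) * ((m : ℝ) + 1) + (x - m) * (m + 1 + 1) = x + 1 by ring,
    Real.Gamma_add_one (s := (m : ℝ) + 1) (by positivity), Real.Gamma_nat_eq_factorial,
    Real.log_mul (by positivity) (by positivity)] at hconv
  have hfac := log_factorial_le hm
  have hlogm : Real.log m ≤ Real.log x := Real.log_le_log (by positivity) hmx
  have hlogm1 : Real.log (m + 1) ≤ Real.log 2 + Real.log x := by
    rw [← Real.log_mul two_ne_zero hx0.ne']
    exact Real.log_le_log (by positivity) (by linarith)
  have hlog2 : Real.log 2 < 1 := by linarith [Real.log_two_lt_d9]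
  have h1 : (x - m) * Real.log (m + 1) ≤ (x - m) * (1 + Real.log x) :=
    mul_le_mul_of_nonneg_left (by linarith) (by linarith)
  have h2 : (m : ℝ) * Real.log m ≤ m * Real.log x :=
    mul_le_mul_of_nonneg_left hlogm (by positivity)
  nlinarith

theorem half_le_Gamma_natCast_div_two_add_one {n : ℕ} (hn : 1 ≤ n) :
    1 / 2 ≤ Real.Gamma (n / 2 + 1) := by
  rcases hn.eq_or_lt with rfl | h
  · rw [Nat.cast_one, Real.Gamma_add_one (by norm_num), Real.Gamma_one_half_eq]
    have : 1 ≤ √Real.pi := Real.one_le_sqrt.2 (by linarith [Real.pi_gt_three])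
    linarith
  · have h2 : (2 : ℝ) ≤ n := by exact_mod_cast h
    have := Real.Gamma_strictMonoOn_Ici.monotoneOn (a := 2) (b := (n : ℝ) / 2 + 1) (by simp)
      (Set.mem_Ici.2 (by linarith)) (by linarith)
    rw [Real.Gamma_two] at this
    linarith

theorem kConst_pos {n : ℕ} (hn : 1 ≤ n) {p : ℝ} (hp : 0 < p) : 0 < kConst n p := by
  have h1 : 0 < Real.Gamma ((n : ℝ) / 2 + 1) := Real.Gamma_pos_of_pos (by positivity)
  have h2 : 0 < Real.Gamma ((n : ℝ) / p + 1) := Real.Gamma_pos_of_pos (by positivity)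
  have h3 := Real.pi_pos
  have h4 : (0 : ℝ) < n := by exact_mod_cast hn
  unfold kConst
  positivity

theorem log_kConst {n : ℕ} (hn : 1 ≤ n) {p : ℝ} (hp : 0 < p) :
    Real.log (kConst n p) = Real.log Real.pi / 2 + 1 / p * Real.log (p / n) + 1 / p +
      1 / n * Real.log (Real.Gamma (n / p + 1)) - 1 / n * Real.log (Real.Gamma (n / 2 + 1)) := by
  have h1 : 0 < Real.Gamma ((n : ℝ) / 2 + 1) := Real.Gamma_pos_of_pos (by positivity)
  have h2 : 0 < Real.Gamma ((n : ℝ) / p + 1) := Real.Gamma_pos_of_pos (by positivity)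
  have h3 := Real.pi_pos
  have h4 : (0 : ℝ) < n := by exact_mod_cast hn
  rw [kConst, Real.log_div (by positivity) (by positivity), Real.log_mul (by positivity)
    (by positivity), Real.log_mul (by positivity) (by positivity), Real.log_mul (by positivity)
    (by positivity), Real.log_exp, Real.log_rpow h1, Real.log_rpow h2, Real.log_rpow (by positivity),
    Real.log_sqrt h3.le]

/-- With x = n/p, the terms x log x and x in log Γ(x+1) cancel against those from (p/n)^(1/p)
e^(1/p). What is left is at most (4 + (log x)/2)/n, and n ≥ 1. -/
theorem kConst_le_mul_sqrt {n : ℕ} (hn : 1 ≤ n) {p : ℝ} (hp : 0 < p) (hx : 1 ≤ (n : ℝ) / p) :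
    kConst n p ≤ Real.exp (Real.log Real.pi / 2 + 4) * √((n : ℝ) / p) := by
  have hn0 : (0 : ℝ) < n := by exact_mod_cast hn
  have hn1 : (1 : ℝ) ≤ n := by exact_mod_cast hn
  have hx0 : 0 < (n : ℝ) / p := by positivity
  rw [← Real.log_le_log_iff (kConst_pos hn hp) (by positivity), log_kConst hn hp,
    Real.log_mul (Real.exp_pos _).ne' (by positivity), Real.log_exp, Real.log_sqrt hx0.le]
  have h1 := log_Gamma_add_one_le hx
  have h2 := Real.log_le_log (by norm_num) (half_le_Gamma_natCast_div_two_add_one hn)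
  rw [one_div, Real.log_inv] at h2
  have h3 : Real.log 2 < 1 := by linarith [Real.log_two_lt_d9]
  have h4 : 0 ≤ Real.log ((n : ℝ) / p) := Real.log_nonneg hx
  have h5 : 1 / p = 1 / n * (n / p) := by field_simp
  rw [h5, ← inv_div (n : ℝ) p, Real.log_inv]
  set x := (n : ℝ) / p
  have h6 : (0 : ℝ) < 1 / n := by positivity
  have h7 : (1 : ℝ) / n ≤ 1 := by rw [div_le_one hn0]; exact hn1
  set s := (1 : ℝ) / n
  have h8 : s * (Real.log (Real.Gamma (x + 1)) - x * Real.log x + x -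
      Real.log (Real.Gamma (n / 2 + 1))) ≤ s * (4 + Real.log x / 2) :=
    mul_le_mul_of_nonneg_left (by linarith) h6.le
  have h9 : s * (4 + Real.log x / 2) ≤ 1 * (4 + Real.log x / 2) :=
    mul_le_mul_of_nonneg_right h7 (by linarith)
  nlinarith

/-- Since p/2 = n/(2x) with x = n/p, the left side is n^(-1/2) (2x/n)^(1/(2n)), and the exponent
1/(2n) is at most 1/2. -/
theorem one_div_sqrt_mul_rpow_le {n : ℕ} (hn : 1 ≤ n) {p : ℝ} (hp : 0 < p)
    (hx : 1 ≤ (n : ℝ) / p) :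
    1 / ((n : ℝ) ^ (1 / 2 : ℝ) * (p / 2) ^ (1 / (2 * (n : ℝ)))) ≤ √2 * √((n : ℝ) / p) := by
  have hn0 : (0 : ℝ) < n := by exact_mod_cast hn
  have hn1 : (1 : ℝ) ≤ n := by exact_mod_cast hn
  have hx0 : 0 < (n : ℝ) / p := by positivity
  rw [← Real.log_le_log_iff (by positivity) (by positivity), one_div, Real.log_inv,
    Real.log_mul (by positivity) (by positivity), Real.log_rpow hn0, Real.log_rpow (by positivity),
    Real.log_mul (by positivity) (by positivity), Real.log_sqrt hx0.le, Real.log_sqrt two_pos.le]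
  have hp2 : p / 2 = n / (2 * (n / p)) := by field_simp
  rw [hp2, Real.log_div hn0.ne' (by positivity), Real.log_mul two_ne_zero hx0.ne']
  have h1 : 0 ≤ Real.log ((n : ℝ) / p) := Real.log_nonneg hx
  have h2 : 0 ≤ Real.log n := Real.log_nonneg hn1
  have h3 : 0 < Real.log 2 := Real.log_pos one_lt_two
  have h4 : (0 : ℝ) < 1 / (2 * n) := by positivity
  have h5 : (1 : ℝ) / (2 * n) ≤ 1 / 2 := by
    rw [div_le_div_iff₀ (by positivity) two_pos]; linarith
  nlinarith [mul_nonneg h4.le h2, mul_le_mul_of_nonneg_right h5 (add_nonneg h3.le h1)]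

theorem kConst_sub_isLittleO :
    (fun q : ℕ × ℝ => kConst q.1 q.2 -
        √(2 * Real.pi * Real.exp 1) *
          (1 / ((q.1 : ℝ) ^ (1 / 2 : ℝ) * (q.2 / 2) ^ (1 / (2 * (q.1 : ℝ))))))
      =o[Filter.comap (fun q : ℕ × ℝ => (q.1 : ℝ) / q.2) Filter.atTop]
        (fun q : ℕ × ℝ => (q.1 : ℝ) / q.2) := by
  have hev : ∀ᶠ q : ℕ × ℝ in Filter.comap (fun q : ℕ × ℝ => (q.1 : ℝ) / q.2) Filter.atTop,
      1 ≤ (q.1 : ℝ) / q.2 := Filter.tendsto_comap.eventually (Filter.eventually_ge_atTop 1)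
  have hsqrt : (fun q : ℕ × ℝ => √((q.1 : ℝ) / q.2))
      =o[Filter.comap (fun q : ℕ × ℝ => (q.1 : ℝ) / q.2) Filter.atTop]
        (fun q : ℕ × ℝ => (q.1 : ℝ) / q.2) := by
    refine Asymptotics.isLittleO_iff.2 fun c hc => ?_
    filter_upwards [hev, (Real.tendsto_sqrt_atTop.comp Filter.tendsto_comap).eventually
      (Filter.eventually_ge_atTop (1 / c))] with q hq hqc
    have h0 : 0 ≤ (q.1 : ℝ) / q.2 := zero_le_one.trans hq
    rw [Real.norm_of_nonneg (Real.sqrt_nonneg _), Real.norm_of_nonneg h0]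
    have h1 : 1 ≤ √((q.1 : ℝ) / q.2) * c := (div_le_iff₀ hc).1 hqc
    nlinarith [Real.mul_self_sqrt h0, Real.sqrt_nonneg ((q.1 : ℝ) / q.2)]
  refine Asymptotics.IsBigO.trans_isLittleO (Asymptotics.IsBigO.of_bound
    (Real.exp (Real.log Real.pi / 2 + 4) + √(2 * Real.pi * Real.exp 1) * √2) ?_) hsqrt
  filter_upwards [hev] with q hq
  -- The filter ranges over all pairs, but n/p ≥ 1 already forces n ≥ 1 and p > 0 (with n/0 = 0).
  have hn : 1 ≤ q.1 := by
    by_contra! h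
    rw [Nat.lt_one_iff.1 h] at hq
    norm_num at hq
  have hn0 : (0 : ℝ) < q.1 := by exact_mod_cast hn
  have hp : 0 < q.2 := by
    by_contra! h
    linarith [div_nonpos_of_nonneg_of_nonpos hn0.le h]
  have h1 := kConst_le_mul_sqrt hn hp hq
  have h2 := mul_le_mul_of_nonneg_left (one_div_sqrt_mul_rpow_le hn hp hq)
    (Real.sqrt_nonneg (2 * Real.pi * Real.exp 1))
  have h3 := kConst_pos hn hp
  have h4 : 0 ≤ √(2 * Real.pi * Real.exp 1) *
    (1 / ((q.1 : ℝ) ^ (1 / 2 : ℝ) * (q.2 / 2) ^ (1 / (2 * (q.1 : ℝ))))) := by positivity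
  rw [Real.norm_eq_abs, Real.norm_of_nonneg (Real.sqrt_nonneg _), abs_le, add_mul]
  constructor
  · nlinarith [mul_pos (Real.exp_pos (Real.log Real.pi / 2 + 4))
      (Real.sqrt_pos.2 (zero_lt_one.trans_le hq))]
  · nlinarith

/-! ### Optimising c and passing to the infimum over estimators. -/

theorem half_mul_extLogTwo (n : ℕ) (x : ℝ≥0∞) :
    (((n : ℝ) / 2 : ℝ) : EReal) * extLogTwo x =
      (((n : ℝ) / 2 / Real.log 2 : ℝ) : EReal) * ENNReal.log x := by
  rw [extLogTwo, EReal.mul_div, ← EReal.mul_div_right, EReal.coe_div ((n : ℝ) / 2)]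

/-- Continuity on all of [0, ∞] includes t = 0, which is needed when the mmpe vanishes. -/
theorem continuous_half_mul_extLogTwo (n : ℕ) {K s : ℝ} :
    Continuous fun t : ℝ≥0∞ =>
      (((n : ℝ) / 2 : ℝ) : EReal) * extLogTwo (ENNReal.ofReal K * t ^ s) := by
  simp_rw [half_mul_extLogTwo]
  have hcont : Continuous fun t : ℝ≥0∞ => ENNReal.log (ENNReal.ofReal K * t ^ s) :=
    ENNReal.continuous_log.comp
      ((ENNReal.continuous_const_mul ENNReal.ofReal_ne_top).comp ENNReal.continuous_rpow_const)
  refine continuous_iff_continuousAt.2 fun t => ?_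
  exact EReal.Tendsto.const_mul hcont.continuousAt (Or.inl (EReal.coe_ne_bot _))
    (Or.inl (EReal.coe_ne_top _))

/-- The generalized Gaussian bound at `c = 1 / (p * t)` is the maximum entropy bound. -/
theorem genGaussian_bound_eq {n : ℕ} (hn : 1 ≤ n) {p t : ℝ} (hp : 0 < p) (ht : 0 < t) :
    (((Real.log ((1 / (p * t)) ^ (-((n : ℝ) / p)) * genGaussianConst n p) +
      1 / (p * t) * (n * t)) / Real.log 2 : ℝ) : EReal) =
    (((n : ℝ) / 2 : ℝ) : EReal) * extLogTwo
      (ENNReal.ofReal (kConst n p ^ 2 * (n : ℝ) ^ (2 / p)) * ENNReal.ofReal t ^ (2 / p)) := by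
  have hn0 : (0 : ℝ) < n := by exact_mod_cast hn
  have hk := kConst_pos hn hp
  have h1 : 0 < Real.Gamma ((n : ℝ) / 2 + 1) := Real.Gamma_pos_of_pos (by positivity)
  have h2 : 0 < Real.Gamma ((n : ℝ) / p + 1) := Real.Gamma_pos_of_pos (by positivity)
  have h3 := Real.pi_pos
  have hG := genGaussianConst_pos n hp
  have hlog2 : 0 < Real.log 2 := Real.log_pos one_lt_two
  rw [half_mul_extLogTwo, ENNReal.ofReal_rpow_of_pos ht, ← ENNReal.ofReal_mul (by positivity),
    ENNReal.log_ofReal_of_pos (by positivity), ← EReal.coe_mul, EReal.coe_eq_coe_iff,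
    Real.log_mul (by positivity) hG.ne', Real.log_mul (by positivity) (by positivity),
    Real.log_mul (by positivity) (by positivity), Real.log_pow, Real.log_rpow (by positivity),
    Real.log_rpow (by positivity), Real.log_rpow (by positivity), one_div, Real.log_inv,
    Real.log_mul hp.ne' ht.ne', log_kConst hn hp, genGaussianConst,
    Real.log_mul (by positivity) h2.ne', Real.log_div (by positivity) h1.ne', Real.log_pow,
    Real.log_sqrt h3.le, Real.log_div hp.ne' hn0.ne']
  field_simp
  push_cast
  ring

theorem pNorm_rpow {Ω : Type*} [MeasurableSpace Ω] (P : Measure Ω) {n : ℕ} {p : ℝ} (hp : 0 < p)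
    (U : Ω → EuclideanSpace ℝ (Fin n)) :
    pNorm P p U ^ p = (n : ℝ≥0∞)⁻¹ * ∫⁻ ω, ‖U ω‖ₑ ^ p ∂P := by
  rw [pNorm, ← ENNReal.rpow_mul, one_div_mul_cancel hp.ne', ENNReal.rpow_one]

/-- The infimum need not be attained. A level t strictly above it is beaten by an actual estimator,
and is positive even if the mmpe is 0. -/
theorem condDiffEntropy_le_of_mmpe_lt {Ω β : Type*} [MeasurableSpace Ω] [MeasurableSpace β]
    (P : Measure Ω) [IsProbabilityMeasure P] {n : ℕ} (hn : 1 ≤ n) {p : ℝ} (hp : 0 < p)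
    {U : Ω → EuclideanSpace ℝ (Fin n)} (hU : Measurable U) {V : Ω → β} (hV : Measurable V)
    {t : ℝ≥0∞} (hmt : mmpe P U V p < t) (htop : t ≠ ⊤) :
    condDiffEntropy P U V ≤ (((n : ℝ) / 2 : ℝ) : EReal) *
      extLogTwo (ENNReal.ofReal (kConst n p ^ 2 * (n : ℝ) ^ (2 / p)) * t ^ (2 / p)) := by
  have hn0 : (0 : ℝ) < n := by exact_mod_cast hn
  have hn' : (n : ℝ≥0∞) ≠ 0 := by exact_mod_cast (by omega : n ≠ 0)
  have ht : 0 < t.toReal := ENNReal.toReal_pos (bot_le.trans_lt hmt).ne' htop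
  simp only [mmpe, iInf_lt_iff] at hmt
  obtain ⟨f, hf, hft⟩ := hmt
  rw [pNorm_rpow P hp, ← ENNReal.div_eq_inv_mul] at hft
  have hle : ∫⁻ ω, ‖U ω - f (V ω)‖ₑ ^ p ∂P ≤ n * t := by
    rw [mul_comm]
    exact (ENNReal.div_le_iff hn' (ENNReal.natCast_ne_top n)).1 hft.le
  have hnt : (n : ℝ≥0∞) * t ≠ ⊤ := ENNReal.mul_ne_top (ENNReal.natCast_ne_top n) htop
  have hreal : (∫⁻ ω, ‖U ω - f (V ω)‖ₑ ^ p ∂P).toReal ≤ n * t.toReal := by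
    simpa using ENNReal.toReal_mono hnt hle
  -- c = 1/(pt) minimises -(n/p) log c + c n t.
  refine (condDiffEntropy_le_of_estimator P hn hp (c := 1 / (p * t.toReal)) (by positivity)
    hU hV hf (ne_top_of_le_ne_top hnt hle)).trans ?_
  have h := genGaussian_bound_eq hn hp ht
  rw [ENNReal.ofReal_toReal htop] at h
  rw [← h, EReal.coe_le_coe_iff]
  have hlog2 : 0 < Real.log 2 := Real.log_pos one_lt_two
  gcongr

theorem mmpe_lt_top {Ω β : Type*} [MeasurableSpace Ω] [MeasurableSpace β]
    (P : Measure Ω) {n : ℕ} {p : ℝ} (hp : 0 < p) (U : Ω → EuclideanSpace ℝ (Fin n)) (V : Ω → β)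
    (hm : pNorm P p U < ⊤) : mmpe P U V p < ⊤ := by
  -- The zero estimator has error ‖U‖_p^p.
  refine (iInf₂_le (fun _ => 0) measurable_const).trans_lt ?_
  simpa using ENNReal.rpow_lt_top_of_nonneg hp.le hm.ne

/-- The maximum entropy bound on `h(U | V)` in terms of the minimum mean `p`-th error. -/
theorem condDiffEntropy_le_mmpe {Ω β : Type*} [MeasurableSpace Ω] [MeasurableSpace β]
    (P : Measure Ω) [IsProbabilityMeasure P] {n : ℕ} (hn : 1 ≤ n) {p : ℝ} (hp : 0 < p)
    {U : Ω → EuclideanSpace ℝ (Fin n)} (hU : Measurable U) {V : Ω → β} (hV : Measurable V)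
    (hm : pNorm P p U < ⊤) :
    condDiffEntropy P U V ≤ (((n : ℝ) / 2 : ℝ) : EReal) *
      extLogTwo (ENNReal.ofReal (kConst n p ^ 2 * (n : ℝ) ^ (2 / p)) *
        mmpe P U V p ^ (2 / p)) := by
  have hlt := mmpe_lt_top P hp U V hm
  have : (nhdsWithin (mmpe P U V p) (Set.Ioi (mmpe P U V p))).NeBot :=
    nhdsGT_neBot_of_exists_gt ⟨⊤, hlt⟩
  -- Let t decrease to the mmpe; the right neighbourhoods are nontrivial because the mmpe is finite.
  refine ge_of_tendsto ((continuous_half_mul_extLogTwo n).continuousWithinAt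
    (s := Set.Ioi (mmpe P U V p)) (x := mmpe P U V p)) ?_
  filter_upwards [self_mem_nhdsWithin, mem_nhdsWithin_of_mem_nhds (Iio_mem_nhds hlt)] with t h1 h2
  exact condDiffEntropy_le_of_mmpe_lt P hn hp hU hV h1 (ne_of_lt h2)

theorem mainTheorem1 {Ω β : Type*} [MeasurableSpace Ω] [MeasurableSpace β]
    (P : Measure Ω) [IsProbabilityMeasure P] (n : ℕ) (hn : 1 ≤ n) (p : ℝ) (hp : 0 < p)
    (U : Ω → EuclideanSpace ℝ (Fin n)) (hU : Measurable U) (V : Ω → β) (hV : Measurable V)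
    (hh : diffEntropy (P.map U) < ⊤) (hm : pNorm P p U < ⊤) :
    condDiffEntropy P U V ≤
        (((n : ℝ) / 2 : ℝ) : EReal) *
          extLogTwo (ENNReal.ofReal (kConst n p ^ 2 * (n : ℝ) ^ (2 / p)) *
            mmpe P U V p ^ (2 / p)) ∧
      (fun q : ℕ × ℝ => kConst q.1 q.2 -
          √(2 * Real.pi * Real.exp 1) *
            (1 / ((q.1 : ℝ) ^ (1 / 2 : ℝ) * (q.2 / 2) ^ (1 / (2 * (q.1 : ℝ))))))
        =o[Filter.comap (fun q : ℕ × ℝ => (q.1 : ℝ) / q.2) Filter.atTop]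
          (fun q : ℕ × ℝ => (q.1 : ℝ) / q.2) := by
  exact ⟨condDiffEntropy_le_mmpe P hn hp hU hV hm, kConst_sub_isLittleO⟩
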